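/- \textbf{Definitions.} The plane $\mathbb R^2$ carries the norm $\|\cdot\|_\infty$. Let $f:\mathbb R^2\to\mathbb R^2$ be a homeomorphism. A \emph{window} is a set $D\subset\mathbb R^2$ together with a class of homeomorphisms $\chi:\mathbb R^2\to\mathbb R^2$ with $\chi([0,1]^2)=D$ (two homeomorphisms being identified when they agree on an open neighbourhood of $[0,1]^2$) and dimensions $n_u,n_s\ge 0$ with $n_u+n_s=2$. For representatives $\chi_1,\chi_2$ of the class of $D$ put $f_\chi=\chi_2^{-1}\circ f\circ\chi_1$. The window $D$ is \emph{correctly aligned with itself under $f$} if there are representatives $\chi_1,\chi_2$ such that - if $n_u=n_s=1$: $f_\chi([0,1]^2)\subset\mathbb R\times(0,1)$, and $f_\chi$ maps one of the two sides $\{0\}\times[0,1]$, $\{1\}\times[0,1]$ into $(-\infty,0)\times\mathbb R$ and the other one into $(1,\infty)\times\mathbb R$; - if $n_u=0$: $f_\chi([0,1]^2)\subset(0,1)^2$; - if $n_u=2$: $f_\chi^{-1}([0,1]^2)\subset(0,1)^2$. Put $g=f_\chi$ if $n_u\le 1$ and $g=f_\chi^{-1}$ if $n_u=2$. For $\ell\in\{\pm1\}^2$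 let $\mathscr O_\ell=\{x:\ell_1x_1\ge0,\ \ell_2x_2\ge0\}$. A \emph{labeling as per Condition O} is a map $\phi:[0,1]^2\to\{\pm1\}^2$ with $g(z)-z\in\mathscr O_{\phi(z)}$ for all $z$. A square is \emph{completely labeled} if its vertices carry at least three different labels, and \emph{non-degenerate} if none of its edges contains points of three different labels. A \emph{change of labels} is a map $\psi:\{\pm1\}^2\to\{1,2,3\}$ such that $\mathscr O_\ell\subset\mathscr N_{\psi(\ell)}$ for all $\ell$, where $\mathscr N_1,\mathscr N_2,\mathscr N_3$ are convex cones with non-empty interior, each an intersection of half-planes bounded by coordinate axes, which cover $\mathbb R^2$, have pairwise disjoint interiors, and satisfy $\mathscr N_1\cap\mathscr N_2\cap\mathscr N_3=\{0\}$. The \emph{index} $\mathrm{ind}_C(\psi\circ\phi)$ of a square $C$ is $0$ if $\psi\circ\phi$ does not take all the values $1,2,3$ on the vertices of $C$, and otherwise it is the number of edges of $C$, traversed counterclockwise, along which $\psi\circ\phi$ goes from $1$ to $2$, minus the number of those along which it goes from $2$ to $1$. A \emph{subdivision} of $[0,1]^2$ is a finite family of non-degenerate closed squares with sides parallel to the axes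 that cover $[0,1]^2$, have pairwise disjoint interiors, and any two of which are disjoint or meet in a common face. A \emph{$\delta$-approximate fixed point} of $f$ is a point $z$ with $\|f(z)-z\|_\infty<\delta$. \textbf{Proposition.} Let $D$ be a window in $\mathbb R^2$. (i) If $D$ is correctly aligned with itself under $f$, then $f$ has a fixed point in $D$. (ii) Let $D$ be correctly aligned with itself under $f$ by means of the representatives $\chi_1,\chi_2$, and let $\phi$ be a labeling as per Condition O. Then, for every subdivision of $[0,1]^2$ and every change of labels $\psi$, there is a square $C_*$ of the subdivision with $\mathrm{ind}_{C_*}(\psi\circ\phi)\ne0$; and for every square $C_*$ of the subdivision with $\mathrm{ind}_{C_*}(\psi\circ\phi)\neq0$ that is non-degenerate, $f$ has a fixed point in $\chi_1(C_*)$ if $n_u\le1$, respectively in $\chi_1(f_\chi^{-1}(C_*))$ if $n_u=2$. (iii) Let $\chi_1,\chi_2$ be any representatives of the class of $D$ (for instance $\chi_1=\chi_2$) and $\phi$ a labeling as per Condition O. Let $K>1$ and $L>1$, let $\chi_1,\chi_2$ be Lipschitz with constant $K$ and $f_\chi$ bi-Lipschitz with constant $L$, that is, $\frac1L\|x-y\|_\infty\le\|f_\chi(x)-f_\chi(y)\|_\infty\le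 L\|x-y\|_\infty$. Let $\delta>0$ and let $N\ge1$ be an integer with $K(L+1)/N<\delta$. Then for every completely labeled square $C_*$ of a subdivision of $[0,1]^2$ into squares of side $1/N$, each point of $\chi_1(C_*)$ if $n_u\le1$, respectively of $\chi_1(f_\chi^{-1}(C_*))$ if $n_u=2$, is a $\delta$-approximate fixed point of $f$. -/

import Mathlib

open scoped NNReal

namespace Windows2D

/-- The plane; its Mathlib norm and distance are those of the maximum norm. -/
abbrev Plane : Type := Fin 2 → ℝ

/-- The closed unit square. -/
def unitSquare : Set Plane := {z | ∀ i, z i ∈ Set.Icc (0 : ℝ) 1}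

/-- The open unit square. -/
def openUnitSquare : Set Plane := {z | ∀ i, z i ∈ Set.Ioo (0 : ℝ) 1}

/-- Two homeomorphisms of the plane are identified when they agree on an open neighbourhood of
the closed unit square. -/
def chartSetoid : Setoid (Plane ≃ₜ Plane) where
  r χ χ' := ∃ U : Set Plane, IsOpen U ∧ unitSquare ⊆ U ∧ Set.EqOn χ χ' U
  iseqv :=
    { refl := fun _ => ⟨Set.univ, isOpen_univ, Set.subset_univ _, fun _ _ => rfl⟩
      symm := fun ⟨U, hU, hs, he⟩ => ⟨U, hU, hs, he.symm⟩
      trans := fun ⟨U, hU, hs, he⟩ ⟨V, hV, ht, hf⟩ =>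
        ⟨U ∩ V, hU.inter hV, Set.subset_inter hs ht,
          fun _ hx => (he hx.1).trans (hf hx.2)⟩ }

/-- A window in the plane: a homeomorphic copy `carrier` of the unit square, a class of
homeomorphisms of the plane taking the unit square onto it, and unstable- and stable-like
dimensions. The first `nu` coordinates are the unstable-like ones. -/
structure Window where
  carrier : Set Plane
  chartClass : Quotient chartSetoid
  nu : ℕ
  ns : ℕ
  dim_eq : nu + ns = 2
  carrier_eq : ∀ χ : Plane ≃ₜ Plane, Quotient.mk chartSetoid χ = chartClass →
    χ '' unitSquare = carrier

/-- `χ` is a representative of the class of homeomorphisms of `D`. -/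
def Window.IsChart (D : Window) (χ : Plane ≃ₜ Plane) : Prop :=
  Quotient.mk chartSetoid χ = D.chartClass

/-- The exit set: the image of the points of the square with some unstable-like coordinate in
`{0, 1}`. -/
def Window.exitSet (D : Window) : Set Plane :=
  {p | ∃ χ, D.IsChart χ ∧ p ∈ χ '' {z ∈ unitSquare | ∃ i : Fin 2, i.val < D.nu ∧
    (z i = 0 ∨ z i = 1)}}

/-- The entry set: the image of the points of the square with some stable-like coordinate in
`{0, 1}`. -/
def Window.entrySet (D : Window) : Set Plane :=
  {p | ∃ χ, D.IsChart χ ∧ p ∈ χ '' {z ∈ unitSquare | ∃ i : Fin 2, D.nu ≤ i.val ∧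
    (z i = 0 ∨ z i = 1)}}

/-- The map `f` in coordinates, `χ₂⁻¹ ∘ f ∘ χ₁`. -/
def inCharts (f χ₁ χ₂ : Plane ≃ₜ Plane) : Plane ≃ₜ Plane :=
  (χ₁.trans f).trans χ₂.symm

/-- The conditions of correct alignment with one unstable-like and one stable-like coordinate. -/
def CrossesHorizontally (g : Plane → Plane) : Prop :=
  (∀ z ∈ unitSquare, g z 1 ∈ Set.Ioo (0 : ℝ) 1) ∧
    (((∀ z ∈ unitSquare, z 0 = 0 → g z 0 < 0) ∧ (∀ z ∈ unitSquare, z 0 = 1 → 1 < g z 0)) ∨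
     ((∀ z ∈ unitSquare, z 0 = 0 → 1 < g z 0) ∧ (∀ z ∈ unitSquare, z 0 = 1 → g z 0 < 0)))

/-- The representatives `χ₁`, `χ₂` of the classes of `D₁`, `D₂` witness that `D₁` is correctly
aligned with `D₂` under `f`. -/
def AlignedVia (D₁ D₂ : Window) (f χ₁ χ₂ : Plane ≃ₜ Plane) : Prop :=
  D₁.IsChart χ₁ ∧ D₂.IsChart χ₂ ∧ D₁.nu = D₂.nu ∧
    (D₁.nu = 1 → CrossesHorizontally (inCharts f χ₁ χ₂)) ∧
    (D₁.nu = 0 → Set.MapsTo (inCharts f χ₁ χ₂) unitSquare openUnitSquare) ∧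
    (D₁.nu = 2 → Set.MapsTo (inCharts f χ₁ χ₂).symm unitSquare openUnitSquare)

/-- `D₁` is correctly aligned with `D₂` under `f`. -/
def CorrectlyAligned (D₁ D₂ : Window) (f : Plane ≃ₜ Plane) : Prop :=
  ∃ χ₁ χ₂ : Plane ≃ₜ Plane, AlignedVia D₁ D₂ f χ₁ χ₂

/-- Vector labels `(±1, ±1)`. -/
abbrev Label : Type := Fin 2 → ℤˣ

/-- The closed quadrant of a label. -/
def quadrant (l : Label) : Set Plane := {x | ∀ i, 0 ≤ ((l i : ℤ) : ℝ) * x i}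

/-- Condition O for the labeling `φ` of the unit square and the map `g`. As the quadrants are
closed, asking that the displacement lies in the quadrant of the label forces the label in the
open quadrants, leaves two choices on the open half-axes, and all four at the origin. -/
def ConditionO (g : Plane → Plane) (φ : Plane → Label) : Prop :=
  ∀ z ∈ unitSquare, g z - z ∈ quadrant (φ z)

/-- The map by which the labels are assigned: the map in coordinates, or its inverse when both
coordinates are unstable-like. -/
def Window.labelMap (D : Window) (F : Plane ≃ₜ Plane) : Plane ≃ₜ Plane :=
  if D.nu = 2 then F.symm else F

/-- The part of the phase space that corresponds to a subset `C` of the unit square: `χ(C)`, or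
`χ(F⁻¹(C))` when both coordinates are unstable-like. -/
def Window.realize (D : Window) (χ F : Plane ≃ₜ Plane) (C : Set Plane) : Set Plane :=
  if D.nu = 2 then χ '' (F.symm '' C) else χ '' C

/-- A nondegenerate square with sides parallel to the axes, given by its lower left corner and
its side length. -/
structure Square where
  corner : Plane
  side : ℝ
  side_pos : 0 < side

/-- The closed set of points of a square. -/
def Square.toSet (C : Square) : Set Plane :=
  {z | ∀ i, z i ∈ Set.Icc (C.corner i) (C.corner i + C.side)}

/-- The vertices in counterclockwise order. -/
def Square.vertex (C : Square) : Fin 4 → Plane :=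
  ![![C.corner 0, C.corner 1], ![C.corner 0 + C.side, C.corner 1],
    ![C.corner 0 + C.side, C.corner 1 + C.side], ![C.corner 0, C.corner 1 + C.side]]

/-- `E` is one of the four edges of `C`. -/
def Square.IsEdge (C : Square) (E : Set Plane) : Prop :=
  ∃ i, E = {z ∈ C.toSet | z i = C.corner i} ∨ E = {z ∈ C.toSet | z i = C.corner i + C.side}

/-- `F` is a (nonempty) face of `C`: a vertex, an edge, or `C` itself. -/
def Square.IsFace (C : Square) (F : Set Plane) : Prop :=
  (∃ k, F = {C.vertex k}) ∨ C.IsEdge F ∨ F = C.toSet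

/-- A subdivision of the unit square into finitely many squares: they cover it, have disjoint
interiors, and any two of them meet in a common face or not at all. -/
structure IsSubdivision (S : Finset Square) : Prop where
  cover : ⋃ C ∈ S, C.toSet = unitSquare
  interiors : ∀ C ∈ S, ∀ C' ∈ S, C ≠ C' → Disjoint (interior C.toSet) (interior C'.toSet)
  faces : ∀ C ∈ S, ∀ C' ∈ S, C.toSet ∩ C'.toSet = ∅ ∨
    (C.IsFace (C.toSet ∩ C'.toSet) ∧ C'.IsFace (C.toSet ∩ C'.toSet))

/-- The points of `A` carry (at least) three different labels. Three different closed quadrants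
meet only at the origin, so such a set of labels is complete. -/
def CarriesComplete (φ : Plane → Label) (A : Set Plane) : Prop := 3 ≤ (φ '' A).ncard

/-- The vertices of `C` carry three different labels. -/
def CompletelyLabeled (φ : Plane → Label) (C : Square) : Prop :=
  CarriesComplete φ (Set.range C.vertex)

/-- No edge of `C` contains points of three different labels. -/
def NonDegenerate (φ : Plane → Label) (C : Square) : Prop :=
  ∀ E, C.IsEdge E → ¬ CarriesComplete φ E

/-- A convex cone cut out by half-planes bounded by coordinate axes. -/
def IsCoordinateCone (N : Set Plane) : Prop :=
  ∃ H : Set (Fin 2 × ℤˣ), N = {x | ∀ h ∈ H, 0 ≤ ((h.2 : ℤ) : ℝ) * x h.1}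

/-- A special convex polyhedral cone partition of the plane into three (full-dimensional)
cones. -/
structure IsSpecialPartition (N : Fin 3 → Set Plane) : Prop where
  cone : ∀ j, IsCoordinateCone (N j)
  solid : ∀ j, (interior (N j)).Nonempty
  cover : ⋃ j, N j = Set.univ
  interiors : ∀ j k, j ≠ k → Disjoint (interior (N j)) (interior (N k))
  inter : ⋂ j, N j = {0}

/-- A change of labels: each label goes to the number of the cone that contains its quadrant,
for some special partition. The scalar labels `1, 2, 3` are `0, 1, 2` here. -/
def IsChangeOfLabels (ψ : Label → Fin 3) : Prop :=
  ∃ N : Fin 3 → Set Plane, IsSpecialPartition N ∧ ∀ l, quadrant l ⊆ N (ψ l)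

/-- The index of an oriented edge whose end points have scalar labels `a` and `b`. -/
def edgeIndex (a b : Fin 3) : ℤ :=
  if a = 0 ∧ b = 1 then 1 else if a = 1 ∧ b = 0 then -1 else 0

/-- The oriented index of a quadrilateral whose vertices have, in counterclockwise order, the
scalar labels `v 0, v 1, v 2, v 3`. -/
def quadIndex (v : Fin 4 → Fin 3) : ℤ :=
  if Function.Surjective v then ∑ k, edgeIndex (v k) (v (k + 1)) else 0

/-- The index of the square `C` for the vector labeling `φ`, computed with the change of labels
`ψ`. -/
def squareIndex (ψ : Label → Fin 3) (φ : Plane → Label) (C : Square) : ℤ :=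
  quadIndex fun k => ψ (φ (C.vertex k))

/-- `z` is a `δ`-approximate fixed point of `f` (for the maximum norm). -/
def IsApproxFixedPt (δ : ℝ) (f : Plane → Plane) (z : Plane) : Prop := ‖f z - z‖ < δ

end Windows2D

namespace Windows2D

/-! ### Scalar labels and edge indices -/

/-! The proof is a Sperner-type degree argument. `edgeIndex` is antisymmetric, and additive along
paths that miss one scalar label. Hence the indices of the cells of a grid sum to a boundary term,
and if no edge of the big square carries three labels, each side telescopes to its end points: the
total is the index of the big square (`Square.sum_squareIndex_cell`).

A square of nonzero index therefore has cells of nonzero index at every scale. Such a cell is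
completely labeled, so each displacement coordinate takes both weak signs on it, and the
displacement is at most its oscillation there (`norm_displacement_le`). By compactness there is a
fixed point; with Lipschitz constants the same bound gives the approximate version.

Correct alignment fixes one label coordinate on each side of the unit square. So its sides are
nondegenerate, its corners carry all four labels with opposite labels at opposite corners, and its
index is nonzero. The face-to-face condition makes every subdivision contain a full regular grid
(`IsSubdivision.exists_grid`), to which additivity applies. The two charts agree on the unit square,
so fixed points in coordinates are fixed points of `f`. -/

lemma edgeIndex_antisymm (a b : Fin 3) : edgeIndex b a = -edgeIndex a b := by
  revert a b; decide

/-- With one label missing there is no winding: on `{0, 1}` the index is `b - a`, and on the other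
two pairs it vanishes. -/
lemma edgeIndex_trans {a b c d : Fin 3} (ha : a ≠ d) (hb : b ≠ d) (hc : c ≠ d) :
    edgeIndex a b + edgeIndex b c = edgeIndex a c := by
  revert a b c d; decide

/-- The surjectivity guard is redundant, since a closed loop that misses a label has sum zero. This
makes the index additive. -/
lemma quadIndex_eq_sum (v : Fin 4 → Fin 3) :
    quadIndex v = edgeIndex (v 0) (v 1) + edgeIndex (v 1) (v 2) + edgeIndex (v 2) (v 3)
      + edgeIndex (v 3) (v 0) := by
  revert v; decide

/-- Exactly one label is repeated, and at adjacent vertices; contracting that edge leaves a 3-cycle,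
which winds once. -/
lemma quadIndex_ne_zero {v : Fin 4 → Fin 3} (hs : Function.Surjective v) (h₀ : v 0 ≠ v 2)
    (h₁ : v 1 ≠ v 3) : quadIndex v ≠ 0 := by
  revert v; decide

lemma sum_edgeIndex_path {μ : ℕ → Fin 3} {d : Fin 3} {n : ℕ} (h : ∀ i ≤ n, μ i ≠ d) :
    ∑ i ∈ Finset.range n, edgeIndex (μ i) (μ (i + 1)) = edgeIndex (μ 0) (μ n) := by
  induction n with
  | zero => simp only [Finset.range_zero, Finset.sum_empty]; generalize μ 0 = a; revert a; decide
  | succ n ih =>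
    rw [Finset.sum_range_succ, ih fun i hi => h i (by omega)]
    exact edgeIndex_trans (h 0 (by omega)) (h n (by omega)) (h (n + 1) le_rfl)

/-- The sum of the indices of the cells of a labeled grid is the sum over its boundary. -/
lemma sum_grid_edgeIndex (l : ℕ → ℕ → Fin 3) (n m : ℕ) :
    ∑ i ∈ Finset.range n, ∑ j ∈ Finset.range m,
      (edgeIndex (l i j) (l (i + 1) j) + edgeIndex (l (i + 1) j) (l (i + 1) (j + 1))
        + edgeIndex (l (i + 1) (j + 1)) (l i (j + 1)) + edgeIndex (l i (j + 1)) (l i j)) =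
      ∑ i ∈ Finset.range n, edgeIndex (l i 0) (l (i + 1) 0)
        + ∑ j ∈ Finset.range m, edgeIndex (l n j) (l n (j + 1))
        - ∑ i ∈ Finset.range n, edgeIndex (l i m) (l (i + 1) m)
        - ∑ j ∈ Finset.range m, edgeIndex (l 0 j) (l 0 (j + 1)) := by
  have h₁ := Finset.sum_congr (rfl : Finset.range n = Finset.range n) fun i _ =>
    Finset.sum_range_sub (fun j => edgeIndex (l i j) (l (i + 1) j)) m
  have h₂ := Finset.sum_range_sub
    (fun i => ∑ j ∈ Finset.range m, edgeIndex (l i j) (l i (j + 1))) n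
  -- By antisymmetry a cell is a difference of vertical edges (telescoping in `i`) minus a
  -- difference of horizontal edges (telescoping in `j`).
  have h₃ : ∀ i j, edgeIndex (l i j) (l (i + 1) j) + edgeIndex (l (i + 1) j) (l (i + 1) (j + 1))
        + edgeIndex (l (i + 1) (j + 1)) (l i (j + 1)) + edgeIndex (l i (j + 1)) (l i j) =
      (edgeIndex (l (i + 1) j) (l (i + 1) (j + 1)) - edgeIndex (l i j) (l i (j + 1)))
      - (edgeIndex (l i (j + 1)) (l (i + 1) (j + 1)) - edgeIndex (l i j) (l (i + 1) j)) := by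
    intro i j
    rw [edgeIndex_antisymm (l i (j + 1)) (l (i + 1) (j + 1)),
      edgeIndex_antisymm (l i j) (l i (j + 1))]
    ring
  simp only [h₃, Finset.sum_sub_distrib] at h₁ h₂ ⊢
  linarith

/-! ### Complete labelings -/

/-- Only two of the four labels avoid a given sign in a given coordinate, so three labels show both
signs in both coordinates. -/
lemma CarriesComplete.exists_label {φ : Plane → Label} {A : Set Plane} (h : CarriesComplete φ A)
    (i : Fin 2) (u : ℤˣ) : ∃ v ∈ A, φ v i = u := by
  by_contra! hne
  have hs : φ '' A ⊆ ((Finset.univ.filter fun l : Label => l i ≠ u : Finset Label) : Set Label) := by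
    rintro _ ⟨v, hv, rfl⟩
    simpa using hne v hv
  have h₁ := Set.ncard_le_ncard hs (Set.toFinite _)
  rw [Set.ncard_coe_finset] at h₁
  have h₂ : ∀ (i : Fin 2) (u : ℤˣ),
      (Finset.univ.filter fun l : Fin 2 → ℤˣ => l i ≠ u).card ≤ 2 := by decide
  have h₃ : 3 ≤ (φ '' A).ncard := h
  have h₄ := h₃.trans (h₁.trans (h₂ i u))
  omega

lemma completelyLabeled_of_squareIndex_ne_zero {ψ : Label → Fin 3} {φ : Plane → Label}
    {C : Square} (h : squareIndex ψ φ C ≠ 0) : CompletelyLabeled φ C := by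
  have hs : Function.Surjective fun k => ψ (φ (C.vertex k)) := by
    by_contra hs
    exact h (by rw [squareIndex, quadIndex, if_neg hs])
  have hu : ψ '' (φ '' Set.range C.vertex) = Set.univ := by
    refine Set.eq_univ_of_forall fun c => ?_
    obtain ⟨k, hk⟩ := hs c
    exact ⟨_, ⟨_, ⟨k, rfl⟩, rfl⟩, hk⟩
  have hle := Set.ncard_image_le (f := ψ) (Set.toFinite (φ '' Set.range C.vertex))
  rw [hu, Set.ncard_univ, Nat.card_eq_fintype_card, Fintype.card_fin] at hle
  exact hle

/-- At most two vector labels give at most two scalar labels; the missing one is the `d` needed in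
`sum_edgeIndex_path`. -/
lemma exists_scalar_label_ne {φ : Plane → Label} {E : Set Plane} (h : ¬ CarriesComplete φ E)
    (ψ : Label → Fin 3) : ∃ d, ∀ z ∈ E, ψ (φ z) ≠ d := by
  by_contra! hd
  have hu : ψ '' (φ '' E) = Set.univ := by
    refine Set.eq_univ_of_forall fun c => ?_
    obtain ⟨z, hz, hc⟩ := hd c
    exact ⟨_, ⟨z, hz, rfl⟩, hc⟩
  have hle := Set.ncard_image_le (f := ψ) (Set.toFinite (φ '' E))
  rw [hu, Set.ncard_univ, Nat.card_eq_fintype_card, Fintype.card_fin] at hle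
  exact h hle

lemma nonneg_of_mem_quadrant {l : Label} {x : Plane} (h : x ∈ quadrant l) {i : Fin 2}
    (hi : l i = 1) : 0 ≤ x i := by
  simpa [hi] using h i

lemma nonpos_of_mem_quadrant {l : Label} {x : Plane} (h : x ∈ quadrant l) {i : Fin 2}
    (hi : l i = -1) : x i ≤ 0 := by
  simpa [hi] using h i

lemma Square.vertex_mem (C : Square) (k : Fin 4) : C.vertex k ∈ C.toSet := by
  have h := C.side_pos.le
  intro i
  fin_cases k <;> fin_cases i <;> simp [Square.vertex, h]

lemma Square.dist_le {C : Square} {x y : Plane} (hx : x ∈ C.toSet) (hy : y ∈ C.toSet) :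
    dist x y ≤ C.side := by
  refine (dist_pi_le_iff C.side_pos.le).2 fun i => ?_
  have h₁ := hx i
  have h₂ := hy i
  simp only [Set.mem_Icc] at h₁ h₂
  rw [Real.dist_eq, abs_le]
  constructor <;> linarith

/-- On a completely labeled square the displacement is bounded by its oscillation. -/
lemma norm_displacement_le {g : Plane → Plane} {φ : Plane → Label} {C : Square} {r : ℝ}
    (hc : CompletelyLabeled φ C) (hO : ∀ z ∈ C.toSet, g z - z ∈ quadrant (φ z))
    (hr : ∀ z ∈ C.toSet, ∀ w ∈ C.toSet, dist (g z - z) (g w - w) ≤ r)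
    {z : Plane} (hz : z ∈ C.toSet) : ‖g z - z‖ ≤ r := by
  have h0 : 0 ≤ r := dist_nonneg.trans (hr z hz z hz)
  refine (pi_norm_le_iff_of_nonneg h0).2 fun i => ?_
  -- The `i`-th displacement is nonnegative at one vertex and nonpositive at another, and at `z` it
  -- differs from both by at most `r`.
  obtain ⟨_, ⟨k, rfl⟩, hk⟩ := CarriesComplete.exists_label hc i 1
  obtain ⟨_, ⟨m, rfl⟩, hm⟩ := CarriesComplete.exists_label hc i (-1)
  have h₁ := nonneg_of_mem_quadrant (hO _ (C.vertex_mem k)) hk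
  have h₂ := nonpos_of_mem_quadrant (hO _ (C.vertex_mem m)) hm
  have h₃ := (dist_le_pi_dist _ _ i).trans (hr z hz _ (C.vertex_mem k))
  have h₄ := (dist_le_pi_dist _ _ i).trans (hr z hz _ (C.vertex_mem m))
  rw [Real.dist_eq, abs_le] at h₃ h₄
  rw [Real.norm_eq_abs, abs_le]
  constructor <;> linarith [h₃.1, h₄.2]

/-! ### Refinement of a square -/

/-- The points of the regular `n × n` grid in a square. -/
noncomputable def Square.gridPoint (C : Square) (n i j : ℕ) : Plane :=
  ![C.corner 0 + i * (C.side / n), C.corner 1 + j * (C.side / n)]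

/-- The cells of the regular `n × n` grid in a square. -/
noncomputable def Square.cell (C : Square) {n : ℕ} (hn : 0 < n) (i j : ℕ) : Square where
  corner := C.gridPoint n i j
  side := C.side / n
  side_pos := div_pos C.side_pos (Nat.cast_pos.2 hn)

lemma Square.gridPoint_mem (C : Square) {n i j : ℕ} (hi : i ≤ n) (hj : j ≤ n) :
    C.gridPoint n i j ∈ C.toSet := by
  have key : ∀ m : ℕ, m ≤ n → 0 ≤ m * (C.side / n) ∧ m * (C.side / n) ≤ C.side := by
    intro m hm
    have hs := C.side_pos.le
    refine ⟨by positivity, ?_⟩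
    rw [mul_div_left_comm]
    refine mul_le_of_le_one_right hs (div_le_one_of_le₀ (by exact_mod_cast hm) (by positivity))
  have h₁ := key i hi
  have h₂ := key j hj
  intro k
  fin_cases k <;> simp [Square.gridPoint] <;> tauto

lemma Square.cell_toSet_subset (C : Square) {n i j : ℕ} (hn : 0 < n) (hi : i < n) (hj : j < n) :
    (C.cell hn i j).toSet ⊆ C.toSet := by
  intro z hz k
  have h₁ := C.gridPoint_mem hi.le hj.le k
  have h₂ := C.gridPoint_mem (Nat.succ_le_of_lt hi) (Nat.succ_le_of_lt hj) k
  have h₃ := hz k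
  fin_cases k <;>
  · simp [Square.gridPoint, Square.cell] at h₁ h₂ h₃ ⊢
    constructor <;> linarith

lemma Square.squareIndex_cell (C : Square) {n : ℕ} (hn : 0 < n) (ψ : Label → Fin 3)
    (φ : Plane → Label) (i j : ℕ) :
    squareIndex ψ φ (C.cell hn i j) =
      edgeIndex (ψ (φ (C.gridPoint n i j))) (ψ (φ (C.gridPoint n (i + 1) j)))
      + edgeIndex (ψ (φ (C.gridPoint n (i + 1) j))) (ψ (φ (C.gridPoint n (i + 1) (j + 1))))
      + edgeIndex (ψ (φ (C.gridPoint n (i + 1) (j + 1)))) (ψ (φ (C.gridPoint n i (j + 1))))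
      + edgeIndex (ψ (φ (C.gridPoint n i (j + 1)))) (ψ (φ (C.gridPoint n i j))) := by
  rw [squareIndex, quadIndex_eq_sum]
  have h0 : (C.cell hn i j).vertex 0 = C.gridPoint n i j := by
    ext k; fin_cases k <;> simp [Square.vertex, Square.cell, Square.gridPoint]
  have h1 : (C.cell hn i j).vertex 1 = C.gridPoint n (i + 1) j := by
    ext k; fin_cases k <;> simp [Square.vertex, Square.cell, Square.gridPoint]; ring
  have h2 : (C.cell hn i j).vertex 2 = C.gridPoint n (i + 1) (j + 1) := by
    ext k; fin_cases k <;> simp [Square.vertex, Square.cell, Square.gridPoint] <;> ring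
  have h3 : (C.cell hn i j).vertex 3 = C.gridPoint n i (j + 1) := by
    ext k; fin_cases k <;> simp [Square.vertex, Square.cell, Square.gridPoint]; ring
  rw [h0, h1, h2, h3]

/-- If the edges of `C` are nondegenerate, its index is the sum of the indices of the cells of a
grid. -/
lemma Square.sum_squareIndex_cell {C : Square} {φ : Plane → Label} (hC : NonDegenerate φ C)
    (ψ : Label → Fin 3) {n : ℕ} (hn : 0 < n) :
    ∑ i ∈ Finset.range n, ∑ j ∈ Finset.range n, squareIndex ψ φ (C.cell hn i j) =
      squareIndex ψ φ C := by
  have hn' : (n : ℝ) ≠ 0 := Nat.cast_ne_zero.2 hn.ne'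
  have hs : (n : ℝ) * (C.side / n) = C.side := by field_simp
  simp only [C.squareIndex_cell hn]
  rw [sum_grid_edgeIndex fun i j => ψ (φ (C.gridPoint n i j))]
  have side : ∀ (γ : ℕ → Plane) (E : Set Plane), C.IsEdge E → (∀ i ≤ n, γ i ∈ E) →
      ∑ i ∈ Finset.range n, edgeIndex (ψ (φ (γ i))) (ψ (φ (γ (i + 1)))) =
        edgeIndex (ψ (φ (γ 0))) (ψ (φ (γ n))) := by
    intro γ E hE hγ
    obtain ⟨d, hd⟩ := exists_scalar_label_ne (hC E hE) ψ
    exact sum_edgeIndex_path (μ := fun i => ψ (φ (γ i))) fun i hi => hd _ (hγ i hi)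
  rw [side (fun i => C.gridPoint n i 0) _ ⟨1, Or.inl rfl⟩ fun i hi =>
      ⟨C.gridPoint_mem hi hn.le, by simp [Square.gridPoint]⟩,
    side (fun j => C.gridPoint n n j) _ ⟨0, Or.inr rfl⟩ fun j hj =>
      ⟨C.gridPoint_mem le_rfl hj, by simp [Square.gridPoint, hs]⟩,
    side (fun i => C.gridPoint n i n) _ ⟨1, Or.inr rfl⟩ fun i hi =>
      ⟨C.gridPoint_mem hi le_rfl, by simp [Square.gridPoint, hs]⟩,
    side (fun j => C.gridPoint n 0 j) _ ⟨0, Or.inl rfl⟩ fun j hj =>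
      ⟨C.gridPoint_mem hn.le hj, by simp [Square.gridPoint]⟩]
  rw [squareIndex, quadIndex_eq_sum]
  have h0 : C.vertex 0 = C.gridPoint n 0 0 := by simp [Square.vertex, Square.gridPoint]
  have h1 : C.vertex 1 = C.gridPoint n n 0 := by simp [Square.vertex, Square.gridPoint, hs]
  have h2 : C.vertex 2 = C.gridPoint n n n := by simp [Square.vertex, Square.gridPoint, hs]
  have h3 : C.vertex 3 = C.gridPoint n 0 n := by simp [Square.vertex, Square.gridPoint, hs]
  rw [h0, h1, h2, h3, edgeIndex_antisymm (ψ (φ (C.gridPoint n 0 n))) (ψ (φ (C.gridPoint n n n))),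
    edgeIndex_antisymm (ψ (φ (C.gridPoint n 0 0))) (ψ (φ (C.gridPoint n 0 n)))]
  ring

lemma Square.exists_cell_squareIndex_ne_zero {C : Square} {φ : Plane → Label}
    (hC : NonDegenerate φ C) {ψ : Label → Fin 3} (h : squareIndex ψ φ C ≠ 0) {n : ℕ}
    (hn : 0 < n) : ∃ i < n, ∃ j < n, squareIndex ψ φ (C.cell hn i j) ≠ 0 := by
  rw [← Square.sum_squareIndex_cell hC ψ hn] at h
  obtain ⟨i, hi, h⟩ := Finset.exists_ne_zero_of_sum_ne_zero h
  obtain ⟨j, hj, h⟩ := Finset.exists_ne_zero_of_sum_ne_zero h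
  exact ⟨i, Finset.mem_range.1 hi, j, Finset.mem_range.1 hj, h⟩

lemma Square.toSet_eq_Icc (C : Square) :
    C.toSet = Set.Icc C.corner (fun i => C.corner i + C.side) := by
  ext z
  simp only [Square.toSet, Set.mem_ofPred_eq, Set.mem_Icc, Pi.le_def, forall_and]

/-- A continuous map has a fixed point in every nondegenerate square of nonzero index. -/
lemma exists_fixedPt_of_squareIndex_ne_zero {g : Plane → Plane} (hg : Continuous g)
    {φ : Plane → Label} {C : Square} (hO : ∀ z ∈ C.toSet, g z - z ∈ quadrant (φ z))
    (hC : NonDegenerate φ C) {ψ : Label → Fin 3} (h : squareIndex ψ φ C ≠ 0) :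
    ∃ z ∈ C.toSet, g z = z := by
  have hcont : Continuous fun z => g z - z := hg.sub continuous_id
  have hcpt : IsCompact C.toSet := C.toSet_eq_Icc ▸ isCompact_Icc
  -- If the minimal displacement were positive, a cell so small that the oscillation is below half
  -- of it would contain a point with smaller displacement.
  obtain ⟨z₀, hz₀, hmin⟩ := hcpt.exists_isMinOn ⟨_, C.vertex_mem 0⟩ hcont.norm.continuousOn
  refine ⟨z₀, hz₀, ?_⟩
  by_contra hne
  have hpos : 0 < ‖g z₀ - z₀‖ := norm_pos_iff.2 (sub_ne_zero.2 hne)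
  obtain ⟨ε, hε, hunif⟩ := Metric.uniformContinuousOn_iff.1
    (hcpt.uniformContinuousOn_of_continuous hcont.continuousOn) _ (half_pos hpos)
  obtain ⟨n, hn⟩ := exists_nat_gt (C.side / ε)
  have hn0 : 0 < n := by
    have : (0 : ℝ) < n := (div_pos C.side_pos hε).trans hn
    exact_mod_cast this
  have hside : C.side / n < ε := by
    rw [div_lt_iff₀ (Nat.cast_pos.2 hn0)]
    rw [div_lt_iff₀ hε] at hn
    linarith
  obtain ⟨i, hi, j, hj, hij⟩ := Square.exists_cell_squareIndex_ne_zero hC h hn0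
  have hsub := C.cell_toSet_subset hn0 hi hj
  have hle := norm_displacement_le (completelyLabeled_of_squareIndex_ne_zero hij)
    (fun z hz => hO z (hsub hz))
    (fun z hz w hw => (hunif z (hsub hz) w (hsub hw) ((Square.dist_le hz hw).trans_lt hside)).le)
    (Square.vertex_mem _ 0)
  have hge := hmin (hsub (Square.vertex_mem (C.cell hn0 i j) 0))
  simp only [Set.mem_ofPred_eq] at hge
  linarith

/-! ### Subdivisions -/

lemma IsSubdivision.toSet_subset {S : Finset Square} (hS : IsSubdivision S) {C : Square}
    (hC : C ∈ S) : C.toSet ⊆ unitSquare := by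
  rw [← hS.cover]
  exact Set.subset_biUnion_of_mem (u := fun C : Square => C.toSet) hC

lemma Square.corner_mem (C : Square) : C.corner ∈ C.toSet := fun i =>
  ⟨le_rfl, by linarith [C.side_pos]⟩

lemma Square.corner_add_side_mem (C : Square) : (fun i => C.corner i + C.side) ∈ C.toSet :=
  fun i => ⟨by linarith [C.side_pos], le_rfl⟩

lemma Square.isClosed_toSet (C : Square) : IsClosed C.toSet := C.toSet_eq_Icc ▸ isClosed_Icc

lemma Square.interior_nonempty (C : Square) : (interior C.toSet).Nonempty := by
  refine ⟨fun i => C.corner i + C.side / 2, ?_⟩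
  refine interior_maximal (t := {z : Plane | ∀ i, z i ∈ Set.Ioo (C.corner i) (C.corner i + C.side)})
    (fun z hz i => Set.Ioo_subset_Icc_self (hz i)) ?_ ?_
  · simp only [Set.ofPred_forall]
    exact isOpen_iInter_of_finite fun i => isOpen_Ioo.preimage (continuous_apply i)
  · intro i
    constructor <;> linarith [C.side_pos]

lemma Square.vertex_apply (C : Square) (k : Fin 4) (i : Fin 2) :
    C.vertex k i = C.corner i ∨ C.vertex k i = C.corner i + C.side := by
  fin_cases k <;> fin_cases i <;> simp [Square.vertex]

/-- The translate of a square by its side in the coordinate direction `d`. -/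
def Square.shift (C : Square) (d : Fin 2) : Square where
  corner := Function.update C.corner d (C.corner d + C.side)
  side := C.side
  side_pos := C.side_pos

/-- Beyond an edge that is not on the boundary, a subdivision continues with a translate. -/
lemma IsSubdivision.shift_mem {S : Finset Square} (hS : IsSubdivision S) {C : Square}
    (hC : C ∈ S) (d : Fin 2) (hd : C.corner d + C.side < 1) : C.shift d ∈ S := by
  obtain ⟨e, hed, hor⟩ : ∃ e : Fin 2, e ≠ d ∧ ∀ i, i = d ∨ i = e := by
    clear hd; revert d; decide
  have hs := C.side_pos
  -- `γ t y` lies at distance `t` beyond the edge, at position `y` along it.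
  let γ : ℝ → ℝ → Plane := fun t y =>
    Function.update (fun _ => y) d (C.corner d + C.side + t)
  have γd : ∀ t y, γ t y d = C.corner d + C.side + t := fun t y => by simp [γ]
  have γe : ∀ t y, γ t y e = y := fun t y => by simp [γ, hed]
  set m := C.corner e + C.side / 2 with hm
  -- The squares are closed and finitely many, so for small `t` a square containing `γ t m` also
  -- contains the edge midpoint `γ 0 m`.
  have hev : ∀ᶠ t in nhdsWithin (0 : ℝ) (Set.Ioi 0),
      ∀ C' ∈ S, γ t m ∈ C'.toSet → γ 0 m ∈ C'.toSet := by
    refine (Filter.eventually_all_finset S).2 fun C' _ => ?_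
    by_cases hq : γ 0 m ∈ C'.toSet
    · exact Filter.Eventually.of_forall fun _ _ => hq
    · have hγ : Continuous fun t => γ t m :=
        continuous_const.update d (continuous_const.add continuous_id)
      have := hγ.continuousAt.eventually (C'.isClosed_toSet.isOpen_compl.mem_nhds hq)
      filter_upwards [nhdsWithin_le_nhds this] with t ht h using absurd h ht
  have hlt : ∀ᶠ t in nhdsWithin (0 : ℝ) (Set.Ioi 0), t < 1 - (C.corner d + C.side) :=
    nhdsWithin_le_nhds (eventually_lt_nhds (by linarith))
  obtain ⟨t, ⟨ht, htlt⟩, ht0⟩ := ((hev.and hlt).and self_mem_nhdsWithin).exists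
  replace ht0 : 0 < t := ht0
  have hCu := hS.toSet_subset hC
  have hlo := hCu C.corner_mem
  have hhi := hCu C.corner_add_side_mem
  have hp : γ t m ∈ unitSquare := by
    intro i
    have h₁ := hlo i
    have h₂ := hhi i
    simp only [Set.mem_Icc] at h₁ h₂ ⊢
    rcases hor i with rfl | rfl
    · rw [γd]; constructor <;> linarith
    · rw [γe]; constructor <;> linarith
  rw [← hS.cover, Set.mem_iUnion₂] at hp
  obtain ⟨C', hC', hp'⟩ := hp
  have hq' := ht C' hC' hp'
  have hmemC : ∀ y, C.corner e ≤ y → y ≤ C.corner e + C.side → γ 0 y ∈ C.toSet := by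
    intro y h₁ h₂ i
    rcases hor i with rfl | rfl
    · rw [γd]; constructor <;> linarith
    · rw [γe]; exact ⟨h₁, h₂⟩
  have hq : γ 0 m ∈ C.toSet := hmemC m (by linarith) (by linarith)
  have hpC : γ t m ∉ C.toSet := fun h => by
    have := (h d).2
    rw [γd] at this
    linarith
  have hne : C ≠ C' := by
    rintro rfl
    exact hpC hp'
  obtain ⟨hF, hF'⟩ := (hS.faces C hC C' hC').resolve_left (Set.Nonempty.ne_empty ⟨_, hq, hq'⟩)
  -- The midpoint of this edge lies on no other proper face of `C`, and disjoint interiors exclude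
  -- `C` itself.
  have hE : C.toSet ∩ C'.toSet = {z ∈ C.toSet | z d = C.corner d + C.side} := by
    have hqF : γ 0 m ∈ C.toSet ∩ C'.toSet := ⟨hq, hq'⟩
    rcases hF with ⟨k, hk⟩ | ⟨i, hi⟩ | hfull
    · rw [hk, Set.mem_singleton_iff] at hqF
      have h₁ := C.vertex_apply k e
      rw [← hqF, γe] at h₁
      rcases h₁ with h₁ | h₁ <;> linarith
    · rcases hor i with rfl | rfl
      · rcases hi with hi | hi
        · rw [hi] at hqF
          have := hqF.2
          rw [γd] at this
          linarith
        · exact hi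
      · rcases hi with hi | hi <;>
        · rw [hi] at hqF
          have := hqF.2
          rw [γe] at this
          linarith
    · have hsub := interior_mono (Set.inter_eq_left.1 hfull)
      obtain ⟨x, hx⟩ := C.interior_nonempty
      exact ((hS.interiors C hC C' hC' hne).le_bot ⟨hx, hsub hx⟩).elim
  have hmemF : ∀ y, C.corner e ≤ y → y ≤ C.corner e + C.side →
      γ 0 y ∈ C.toSet ∩ C'.toSet := by
    intro y h₁ h₂
    rw [hE]
    exact ⟨hmemC y h₁ h₂, by rw [γd, add_zero]⟩
  have hl := hmemF (C.corner e) le_rfl (by linarith)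
  have hu := hmemF (C.corner e + C.side) (by linarith) le_rfl
  -- Seen from `C'`, the common face contains both ends of the edge, which excludes vertices and
  -- edges in the direction `d`; `γ t m` excludes the far edge and all of `C'`.
  have hcd : C'.corner d = C.corner d + C.side ∧
      C.toSet ∩ C'.toSet = {z ∈ C'.toSet | z d = C.corner d + C.side} := by
    rcases hF' with ⟨k, hk⟩ | ⟨i, hi⟩ | hfull
    · rw [hk, Set.mem_singleton_iff] at hl hu
      have := congrFun (hl.trans hu.symm) e
      rw [γe, γe] at this
      linarith
    · rcases hor i with rfl | rfl
      · rcases hi with hi | hi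
        · have h₁ := (hi ▸ hl).2
          rw [γd, add_zero] at h₁
          exact ⟨h₁.symm, h₁ ▸ hi⟩
        · have h₁ := (hi ▸ hl).2
          have h₂ := (hp' i).2
          rw [γd] at h₁ h₂
          linarith
      · rcases hi with hi | hi <;>
        · have h₁ := (hi ▸ hl).2
          have h₂ := (hi ▸ hu).2
          rw [γe] at h₁ h₂
          linarith
    · exact absurd (hfull.symm ▸ hp' : γ t m ∈ C.toSet ∩ C'.toSet).1 hpC
  obtain ⟨hcd, hE'⟩ := hcd
  have hs' := C'.side_pos
  have hmem' : ∀ y, C'.corner e ≤ y → y ≤ C'.corner e + C'.side →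
      γ 0 y ∈ C.toSet ∩ C'.toSet := by
    intro y h₁ h₂
    rw [hE']
    refine ⟨fun i => ?_, by rw [γd, add_zero]⟩
    rcases hor i with rfl | rfl
    · rw [γd]; constructor <;> linarith
    · rw [γe]; exact ⟨h₁, h₂⟩
  -- The two edges coincide, so their end points determine the corner and side of `C'`.
  have h₁ := (hl.2 e).1
  have h₂ := (hu.2 e).2
  have h₃ := ((hmem' (C'.corner e) le_rfl (by linarith)).1 e).1
  have h₄ := ((hmem' (C'.corner e + C'.side) (by linarith) le_rfl).1 e).2
  rw [γe] at h₁ h₂ h₃ h₄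
  have hce : C'.corner e = C.corner e := le_antisymm h₁ h₃
  have hside : C'.side = C.side := by linarith
  have : C' = C.shift d := by
    rw [Square.shift]
    obtain ⟨c', s', hs'⟩ := C'
    simp only [Square.mk.injEq]
    refine ⟨?_, hside⟩
    ext i
    rcases hor i with rfl | rfl
    · simpa using hcd
    · simpa [hed] using hce
  exact this ▸ hC'

/-- The unit square. -/
def Square.unit : Square := ⟨0, 1, one_pos⟩

lemma Square.unit_toSet : Square.unit.toSet = unitSquare := by
  simp [Square.toSet, Square.unit, unitSquare]

lemma Square.eq_mk {C : Square} {a b s : ℝ} (h0 : C.corner 0 = a) (h1 : C.corner 1 = b)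
    (hs : C.side = s) (hpos : 0 < s) : C = ⟨![a, b], s, hpos⟩ := by
  obtain ⟨c, t, ht⟩ := C
  simp only [Square.mk.injEq]
  refine ⟨?_, hs⟩
  ext i
  fin_cases i
  · exact h0
  · exact h1

/-- A subdivision of the unit square contains all the cells of a regular grid. -/
lemma IsSubdivision.exists_grid {S : Finset Square} (hS : IsSubdivision S) :
    ∃ (n : ℕ) (hn : 0 < n), ∀ i < n, ∀ j < n, Square.unit.cell hn i j ∈ S := by
  have h0 : (0 : Plane) ∈ unitSquare := fun i => by simp
  rw [← hS.cover, Set.mem_iUnion₂] at h0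
  obtain ⟨C, hC, h0C⟩ := h0
  have hcorner : ∀ i, C.corner i = 0 := fun i =>
    le_antisymm (h0C i).1 (hS.toSet_subset hC C.corner_mem i).1
  have hs := C.side_pos
  have hrow : ∀ i : ℕ, (i : ℝ) * C.side < 1 →
      ∃ C' ∈ S, C'.corner 0 = i * C.side ∧ C'.corner 1 = 0 ∧ C'.side = C.side := by
    intro i
    induction i with
    | zero => exact fun _ => ⟨C, hC, by simp [hcorner], hcorner 1, rfl⟩
    | succ i ih =>
      intro hi
      push_cast at hi ⊢
      obtain ⟨C', hC', h₀, h₁, h₂⟩ := ih (by linarith)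
      refine ⟨C'.shift 0, hS.shift_mem hC' 0 (by rw [h₀, h₂]; linarith), ?_, ?_, h₂⟩
      · simp [Square.shift, h₀, h₂]; ring
      · simp [Square.shift, h₁]
  have hgrid : ∀ i j : ℕ, (i : ℝ) * C.side < 1 → (j : ℝ) * C.side < 1 →
      ∃ C' ∈ S, C'.corner 0 = i * C.side ∧ C'.corner 1 = j * C.side ∧ C'.side = C.side := by
    intro i j hi
    induction j with
    | zero => simpa using hrow i hi
    | succ j ih =>
      intro hj
      push_cast at hj ⊢
      obtain ⟨C', hC', h₀, h₁, h₂⟩ := ih (by linarith)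
      refine ⟨C'.shift 1, hS.shift_mem hC' 1 (by rw [h₁, h₂]; linarith), ?_, ?_, h₂⟩
      · simp [Square.shift, h₀]
      · simp [Square.shift, h₁, h₂]; ring
  have hex : ∃ n : ℕ, 1 ≤ (n : ℝ) * C.side := by
    obtain ⟨n, hn⟩ := exists_nat_ge (1 / C.side)
    exact ⟨n, (div_le_iff₀ hs).1 hn⟩
  classical
  let n := Nat.find hex
  have hn1 : 1 ≤ (n : ℝ) * C.side := Nat.find_spec hex
  have hmin : ∀ k < n, (k : ℝ) * C.side < 1 := fun k hk => not_le.1 (Nat.find_min hex hk)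
  have hn : 0 < n := by
    by_contra h
    have : n = 0 := by omega
    rw [this] at hn1
    norm_num at hn1
  have hns : (n : ℝ) * C.side = 1 := by
    refine le_antisymm ?_ hn1
    -- The last square of the bottom row ends at `n * C.side`, which cannot exceed 1.
    obtain ⟨C', hC', h₀, -, h₂⟩ := hrow (n - 1) (hmin _ (by omega))
    have := (hS.toSet_subset hC' C'.corner_add_side_mem 0).2
    rw [h₀, h₂, Nat.cast_sub hn] at this
    push_cast at this
    linarith
  have hside : C.side = 1 / n := by
    rw [eq_div_iff (by positivity)]
    linarith
  refine ⟨n, hn, fun i hi j hj => ?_⟩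
  obtain ⟨C', hC', h₀, h₁, h₂⟩ := hgrid i j (hmin i hi) (hmin j hj)
  rw [hside] at h₀ h₁ h₂
  have := Square.eq_mk h₀ h₁ h₂ (by positivity)
  have hcell : Square.unit.cell hn i j = C' := by
    rw [this, Square.cell]
    simp [Square.unit, Square.gridPoint]
  exact hcell ▸ hC'

/-! ### Changes of labels -/

/-- No coordinate half-plane contains two opposite quadrants, so a cone containing both is the whole
plane and overlaps the interior of another cone. -/
lemma IsChangeOfLabels.ne_neg {ψ : Label → Fin 3} (h : IsChangeOfLabels ψ) (l : Label) :
    ψ l ≠ ψ (-l) := by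
  obtain ⟨N, hN, hψ⟩ := h
  intro heq
  have h₁ := hψ l
  have h₂ := hψ (-l)
  rw [← heq] at h₂
  have huniv : N (ψ l) = Set.univ := by
    obtain ⟨H, hH⟩ := hN.cone (ψ l)
    have hmem : (fun i => ((l i : ℤ) : ℝ)) ∈ quadrant l := fun i => mul_self_nonneg _
    have hmem' : (fun i => -((l i : ℤ) : ℝ)) ∈ quadrant (-l) := fun i => by
      simpa using mul_self_nonneg ((l i : ℤ) : ℝ)
    have k₁ := h₁ hmem
    have k₂ := h₂ hmem'
    rw [hH] at k₁ k₂ ⊢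
    refine Set.eq_univ_of_forall fun x p hp => ?_
    have q₁ : 0 ≤ ((p.2 : ℤ) : ℝ) * ((l p.1 : ℤ) : ℝ) := k₁ p hp
    have q₂ : 0 ≤ ((p.2 : ℤ) : ℝ) * -((l p.1 : ℤ) : ℝ) := k₂ p hp
    have q₃ : ((p.2 : ℤ) : ℝ) * ((l p.1 : ℤ) : ℝ) ≠ 0 := by
      exact_mod_cast mul_ne_zero p.2.ne_zero (l p.1).ne_zero
    exact absurd (le_antisymm (by linarith) q₁) q₃
  obtain ⟨k, hk⟩ : ∃ k, ψ l ≠ k := by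
    generalize ψ l = a
    revert a; decide
  obtain ⟨x, hx⟩ := hN.solid k
  refine (hN.interiors (ψ l) k hk).le_bot ⟨?_, hx⟩
  rw [huniv, interior_univ]
  trivial

/-- The interior of each cone meets some open quadrant, and the cone containing that quadrant must
then be the same one. -/
lemma IsChangeOfLabels.surjective {ψ : Label → Fin 3} (h : IsChangeOfLabels ψ) :
    Function.Surjective ψ := by
  obtain ⟨N, hN, hψ⟩ := h
  intro k
  obtain ⟨x, hx⟩ := hN.solid k
  obtain ⟨ε, hε, hball⟩ := Metric.isOpen_iff.1 isOpen_interior x hx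
  let l : Label := fun i => if 0 ≤ x i then 1 else -1
  -- Moving each coordinate by `ε / 2` away from zero leaves the axes and stays in the ball.
  let y : Plane := fun i => x i + ((l i : ℤ) : ℝ) * (ε / 2)
  have hy : y ∈ interior (N k) := by
    refine hball ?_
    rw [Metric.mem_ball, dist_pi_lt_iff hε]
    intro i
    simp only [y, l, Real.dist_eq, add_sub_cancel_left]
    split_ifs <;> simp [abs_of_pos (half_pos hε), hε]
  have hy' : y ∈ interior (N (ψ l)) := by
    refine interior_maximal (t := {z : Plane | ∀ i, 0 < ((l i : ℤ) : ℝ) * z i})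
      (fun z hz => hψ l fun i => (hz i).le) ?_ ?_
    · simp only [Set.ofPred_forall]
      exact isOpen_iInter_of_finite fun i =>
        isOpen_lt continuous_const (continuous_const.mul (continuous_apply i))
    · intro i
      simp only [y, l]
      split_ifs with hi
      · simp; linarith
      · simp; linarith
  refine ⟨l, ?_⟩
  by_contra hne
  exact (hN.interiors _ _ hne).le_bot ⟨hy', hy⟩

/-! ### Labels on the boundary of the unit square -/

/-- The labels on the sides of the unit square that correct alignment forces; `u` is the sign of
the first coordinate on the left side. -/
def BoundaryLabels (φ : Plane → Label) (u : ℤˣ) : Prop :=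
  ∀ z ∈ unitSquare, (z 0 = 0 → φ z 0 = u) ∧ (z 0 = 1 → φ z 0 = -u) ∧
    (z 1 = 0 → φ z 1 = 1) ∧ (z 1 = 1 → φ z 1 = -1)

lemma not_carriesComplete_of_const {φ : Plane → Label} {E : Set Plane} {i : Fin 2} {u : ℤˣ}
    (h : ∀ z ∈ E, φ z i = u) : ¬ CarriesComplete φ E := fun hE => by
  obtain ⟨v, hv, hvi⟩ := hE.exists_label i (-u)
  rw [h v hv] at hvi
  exact units_ne_neg_self u hvi

lemma BoundaryLabels.nonDegenerate {φ : Plane → Label} {u : ℤˣ} (h : BoundaryLabels φ u) :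
    NonDegenerate φ Square.unit := by
  rintro E ⟨i, hi⟩
  have key : ∃ w, ∀ z ∈ E, φ z i = w := by
    rcases hi with rfl | rfl <;> fin_cases i
    · refine ⟨u, fun z hz => (h z (Square.unit_toSet ▸ hz.1)).1 ?_⟩
      simpa [Square.unit] using hz.2
    · refine ⟨1, fun z hz => (h z (Square.unit_toSet ▸ hz.1)).2.2.1 ?_⟩
      simpa [Square.unit] using hz.2
    · refine ⟨-u, fun z hz => (h z (Square.unit_toSet ▸ hz.1)).2.1 ?_⟩
      simpa [Square.unit] using hz.2
    · refine ⟨-1, fun z hz => (h z (Square.unit_toSet ▸ hz.1)).2.2.2 ?_⟩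
      simpa [Square.unit] using hz.2
  obtain ⟨w, hw⟩ := key
  exact not_carriesComplete_of_const hw

/-- The four corners carry all four labels, with opposite labels at opposite corners, so the
conditions on `ψ` are those of `quadIndex_ne_zero`. -/
lemma BoundaryLabels.squareIndex_ne_zero {φ : Plane → Label} {u : ℤˣ} (h : BoundaryLabels φ u)
    {ψ : Label → Fin 3} (hs : Function.Surjective ψ) (hn : ∀ l, ψ l ≠ ψ (-l)) :
    squareIndex ψ φ Square.unit ≠ 0 := by
  have hv := fun k => h _ (Square.unit_toSet ▸ Square.unit.vertex_mem k)
  have h0 : φ (Square.unit.vertex 0) = ![u, 1] := by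
    ext i; fin_cases i
    · simp [(hv 0).1 (by simp [Square.vertex, Square.unit])]
    · simp [(hv 0).2.2.1 (by simp [Square.vertex, Square.unit])]
  have h1 : φ (Square.unit.vertex 1) = ![-u, 1] := by
    ext i; fin_cases i
    · simp [(hv 1).2.1 (by simp [Square.vertex, Square.unit])]
    · simp [(hv 1).2.2.1 (by simp [Square.vertex, Square.unit])]
  have h2 : φ (Square.unit.vertex 2) = -![u, 1] := by
    ext i; fin_cases i
    · simp [(hv 2).2.1 (by simp [Square.vertex, Square.unit])]
    · simp [(hv 2).2.2.2 (by simp [Square.vertex, Square.unit])]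
  have h3 : φ (Square.unit.vertex 3) = -![-u, 1] := by
    ext i; fin_cases i
    · simp [(hv 3).1 (by simp [Square.vertex, Square.unit])]
    · simp [(hv 3).2.2.2 (by simp [Square.vertex, Square.unit])]
  refine quadIndex_ne_zero (fun c => ?_) (by rw [h0, h2]; exact hn _)
    (by rw [h1, h3]; exact hn _)
  obtain ⟨l, rfl⟩ := hs c
  have hl : ∀ (u : ℤˣ) (l : Fin 2 → ℤˣ),
      l = ![u, 1] ∨ l = ![-u, 1] ∨ l = -![u, 1] ∨ l = -![-u, 1] := by decide
  rcases hl u l with rfl | rfl | rfl | rfl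
  · exact ⟨0, by rw [← h0]⟩
  · exact ⟨1, by rw [← h1]⟩
  · exact ⟨2, by rw [← h2]⟩
  · exact ⟨3, by rw [← h3]⟩

lemma label_eq_one_of_pos {l : Label} {x : Plane} (h : x ∈ quadrant l) {i : Fin 2}
    (hx : 0 < x i) : l i = 1 :=
  (Int.units_eq_one_or (l i)).resolve_right fun hl =>
    absurd (nonpos_of_mem_quadrant h hl) (not_le.2 hx)

lemma label_eq_neg_one_of_neg {l : Label} {x : Plane} (h : x ∈ quadrant l) {i : Fin 2}
    (hx : x i < 0) : l i = -1 :=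
  (Int.units_eq_one_or (l i)).resolve_left fun hl =>
    absurd (nonneg_of_mem_quadrant h hl) (not_le.2 hx)

lemma boundaryLabels_of_mapsTo {g : Plane → Plane} {φ : Plane → Label}
    (hg : Set.MapsTo g unitSquare openUnitSquare) (hO : ConditionO g φ) :
    BoundaryLabels φ 1 := by
  intro z hz
  have h₀ := hg hz 0
  have h₁ := hg hz 1
  have hq := hO z hz
  refine ⟨fun h => label_eq_one_of_pos hq ?_, fun h => label_eq_neg_one_of_neg hq ?_,
    fun h => label_eq_one_of_pos hq ?_, fun h => label_eq_neg_one_of_neg hq ?_⟩ <;>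
  · simp only [Pi.sub_apply, h]
    linarith [h₀.1, h₀.2, h₁.1, h₁.2]

lemma CrossesHorizontally.boundaryLabels {g : Plane → Plane} {φ : Plane → Label}
    (hg : CrossesHorizontally g) (hO : ConditionO g φ) : ∃ u, BoundaryLabels φ u := by
  obtain ⟨h₁, ⟨hl, hr⟩ | ⟨hl, hr⟩⟩ := hg
  · refine ⟨-1, fun z hz => ⟨fun h => label_eq_neg_one_of_neg (hO z hz) ?_, fun h => ?_,
      fun h => label_eq_one_of_pos (hO z hz) ?_, fun h => label_eq_neg_one_of_neg (hO z hz) ?_⟩⟩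
    · have := hl z hz h
      simp only [Pi.sub_apply, h]; linarith
    · rw [neg_neg]
      refine label_eq_one_of_pos (hO z hz) ?_
      have := hr z hz h
      simp only [Pi.sub_apply, h]; linarith
    · simp only [Pi.sub_apply, h]; linarith [(h₁ z hz).1]
    · simp only [Pi.sub_apply, h]; linarith [(h₁ z hz).2]
  · refine ⟨1, fun z hz => ⟨fun h => label_eq_one_of_pos (hO z hz) ?_,
      fun h => label_eq_neg_one_of_neg (hO z hz) ?_,
      fun h => label_eq_one_of_pos (hO z hz) ?_, fun h => label_eq_neg_one_of_neg (hO z hz) ?_⟩⟩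
    · have := hl z hz h
      simp only [Pi.sub_apply, h]; linarith
    · have := hr z hz h
      simp only [Pi.sub_apply, h]; linarith
    · simp only [Pi.sub_apply, h]; linarith [(h₁ z hz).1]
    · simp only [Pi.sub_apply, h]; linarith [(h₁ z hz).2]

lemma AlignedVia.boundaryLabels {D : Window} {f χ₁ χ₂ : Plane ≃ₜ Plane} {φ : Plane → Label}
    (h : AlignedVia D D f χ₁ χ₂) (hO : ConditionO (D.labelMap (inCharts f χ₁ χ₂)) φ) :
    ∃ u, BoundaryLabels φ u := by
  obtain ⟨-, -, -, h1, h0, h2⟩ := h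
  have hnu : D.nu = 0 ∨ D.nu = 1 ∨ D.nu = 2 := by
    have := D.dim_eq
    omega
  rcases hnu with hnu | hnu | hnu
  · rw [Window.labelMap, if_neg (by omega)] at hO
    exact ⟨1, boundaryLabels_of_mapsTo (h0 hnu) hO⟩
  · rw [Window.labelMap, if_neg (by omega)] at hO
    exact (h1 hnu).boundaryLabels hO
  · rw [Window.labelMap, if_pos hnu] at hO
    exact ⟨1, boundaryLabels_of_mapsTo (h2 hnu) hO⟩

/-! ### Windows -/

/-- This is what lets two different representatives behave as a single chart at points of the
square. -/
lemma Window.IsChart.eqOn {D : Window} {χ₁ χ₂ : Plane ≃ₜ Plane} (h₁ : D.IsChart χ₁)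
    (h₂ : D.IsChart χ₂) : Set.EqOn χ₁ χ₂ unitSquare := by
  obtain ⟨U, -, hU, he⟩ := Quotient.exact (h₁.trans h₂.symm)
  exact he.mono hU

/-- A fixed point of the map in coordinates yields a fixed point in the window. -/
lemma exists_fixedPt_realize {D : Window} {f χ₁ χ₂ : Plane ≃ₜ Plane} {A : Set Plane}
    (hχ : Set.EqOn χ₁ χ₂ unitSquare) (hA : A ⊆ unitSquare)
    (h : ∃ z ∈ A, D.labelMap (inCharts f χ₁ χ₂) z = z) :
    ∃ p ∈ D.realize χ₁ (inCharts f χ₁ χ₂) A, p ∈ χ₁ '' A ∧ f p = p := by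
  obtain ⟨z, hz, hfix⟩ := h
  have hF : inCharts f χ₁ χ₂ z = z := by
    rw [Window.labelMap] at hfix
    split_ifs at hfix
    · exact ((Homeomorph.symm_apply_eq _).1 hfix).symm
    · exact hfix
  refine ⟨χ₁ z, ?_, ⟨z, hz, rfl⟩, ?_⟩
  · rw [Window.realize]
    split_ifs
    -- A fixed point in `A` also lies in `F⁻¹(A)`, being its own preimage.
    · exact ⟨z, ⟨z, hz, (Homeomorph.symm_apply_eq _).2 hF.symm⟩, rfl⟩
    · exact ⟨z, hz, rfl⟩
  · rw [hχ (hA hz)]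
    have : f (χ₁ z) = χ₂ z := (Homeomorph.symm_apply_eq χ₂).1 hF
    rwa [hχ (hA hz)] at this

lemma exists_conditionO (g : Plane → Plane) : ∃ φ, ConditionO g φ := by
  refine ⟨fun z i => if 0 ≤ (g z - z) i then 1 else -1, fun z _ i => ?_⟩
  dsimp only
  split_ifs with h
  · simpa using h
  · simp at h ⊢
    exact h.le

/-- The approximate fixed point estimate on a completely labeled square. -/
lemma isApproxFixedPt_of_completelyLabeled {D : Window} {f χ₁ χ₂ : Plane ≃ₜ Plane}
    {φ : Plane → Label} (hχ : Set.EqOn χ₁ χ₂ unitSquare)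
    (hO : ConditionO (D.labelMap (inCharts f χ₁ χ₂)) φ) {K L : ℝ≥0}
    (hK₁ : LipschitzWith K χ₁) (hK₂ : LipschitzWith K χ₂)
    (hL : LipschitzWith L (inCharts f χ₁ χ₂)) (hL' : AntilipschitzWith L (inCharts f χ₁ χ₂))
    {C : Square} {δ : ℝ} (hC : C.toSet ⊆ unitSquare) (hδ : K * ((L + 1) * C.side) < δ)
    (hcl : CompletelyLabeled φ C) {p : Plane}
    (hp : p ∈ D.realize χ₁ (inCharts f χ₁ χ₂) C.toSet) : IsApproxFixedPt δ f p := by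
  set F := inCharts f χ₁ χ₂ with hF
  have hlip : LipschitzWith L (D.labelMap F) := by
    rw [Window.labelMap]
    split_ifs
    · exact hL'.to_rightInverse F.apply_symm_apply
    · exact hL
  have hf : ∀ z, f (χ₁ z) = χ₂ (F z) := fun z => by
    rw [hF, inCharts, Homeomorph.trans_apply, Homeomorph.trans_apply, Homeomorph.apply_symm_apply]
  have hbound : ∀ z ∈ C.toSet, dist (D.labelMap F z) z ≤ (L + 1) * C.side := by
    intro z hz
    rw [dist_eq_norm]
    refine norm_displacement_le hcl (fun w hw => hO w (hC hw)) (fun z hz w hw => ?_) hz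
    have h₁ := Square.dist_le hz hw
    have h₂ := (hlip.dist_le_mul z w).trans (mul_le_mul_of_nonneg_left h₁ L.2)
    calc dist (D.labelMap F z - z) (D.labelMap F w - w)
        ≤ dist (D.labelMap F z) (D.labelMap F w) + dist z w := dist_sub_sub_le _ _ _ _
      _ ≤ L * C.side + C.side := add_le_add h₂ h₁
      _ = (L + 1) * C.side := by ring
  rw [IsApproxFixedPt, ← dist_eq_norm]
  rw [Window.realize] at hp
  refine lt_of_le_of_lt ?_ hδ
  split_ifs at hp with hnu
  -- Here `p = χ₁ (F⁻¹ z)` and `f p = χ₂ z = χ₁ z`, so `χ₁` carries the estimate; in the other case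
  -- `f p = χ₂ (F z)` and `p = χ₂ z`.
  · obtain ⟨_, ⟨z, hz, rfl⟩, rfl⟩ := hp
    have h := hbound z hz
    rw [Window.labelMap, if_pos hnu, dist_comm] at h
    rw [hf, Homeomorph.apply_symm_apply, ← hχ (hC hz)]
    exact (hK₁.dist_le_mul _ _).trans (mul_le_mul_of_nonneg_left h K.2)
  · obtain ⟨z, hz, rfl⟩ := hp
    have h := hbound z hz
    rw [Window.labelMap, if_neg hnu] at h
    rw [hf, hχ (hC hz)]
    exact (hK₂.dist_le_mul _ _).trans (mul_le_mul_of_nonneg_left h K.2)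

lemma AlignedVia.exists_fixedPt {D : Window} {f χ₁ χ₂ : Plane ≃ₜ Plane}
    (h : AlignedVia D D f χ₁ χ₂) : ∃ p ∈ D.carrier, f p = p := by
  obtain ⟨φ, hφ⟩ := exists_conditionO (D.labelMap (inCharts f χ₁ χ₂))
  obtain ⟨u, hu⟩ := h.boundaryLabels hφ
  -- The upper quadrants share a label and each lower one has its own; only surjectivity and
  -- distinct values on opposite labels are needed.
  let ψ : (Fin 2 → ℤˣ) → Fin 3 := fun l => if l 1 = 1 then 0 else if l 0 = 1 then 1 else 2
  have hfix := exists_fixedPt_of_squareIndex_ne_zero (D.labelMap (inCharts f χ₁ χ₂)).continuous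
    (fun z hz => hφ z (Square.unit_toSet ▸ hz)) hu.nonDegenerate
    (hu.squareIndex_ne_zero (ψ := ψ) (by decide) (by decide))
  obtain ⟨p, -, hp, hfp⟩ :=
    exists_fixedPt_realize (h.1.eqOn h.2.1) Square.unit_toSet.subset hfix
  rw [Square.unit_toSet, D.carrier_eq χ₁ h.1] at hp
  exact ⟨p, hp, hfp⟩

end Windows2D

theorem mainTheorem4 (f : Windows2D.Plane ≃ₜ Windows2D.Plane) (D : Windows2D.Window) :
    -- a fixed point in the window
    (Windows2D.CorrectlyAligned D D f → ∃ p ∈ D.carrier, f p = p) ∧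
    -- subdivisions and indices
    (∀ (χ₁ χ₂ : Windows2D.Plane ≃ₜ Windows2D.Plane)
        (φ : Windows2D.Plane → Windows2D.Label),
      Windows2D.AlignedVia D D f χ₁ χ₂ →
      Windows2D.ConditionO (D.labelMap (Windows2D.inCharts f χ₁ χ₂)) φ →
      ∀ S : Finset Windows2D.Square, Windows2D.IsSubdivision S →
      ∀ ψ : Windows2D.Label → Fin 3, Windows2D.IsChangeOfLabels ψ →
        (∃ C ∈ S, Windows2D.squareIndex ψ φ C ≠ 0) ∧
        (∀ C ∈ S, Windows2D.squareIndex ψ φ C ≠ 0 → Windows2D.NonDegenerate φ C →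
          ∃ p ∈ D.realize χ₁ (Windows2D.inCharts f χ₁ χ₂) C.toSet, f p = p)) ∧
    -- approximate fixed points
    (∀ (χ₁ χ₂ : Windows2D.Plane ≃ₜ Windows2D.Plane)
        (φ : Windows2D.Plane → Windows2D.Label),
      D.IsChart χ₁ → D.IsChart χ₂ →
      Windows2D.ConditionO (D.labelMap (Windows2D.inCharts f χ₁ χ₂)) φ →
      ∀ K L : ℝ≥0, 1 < K → 1 < L →
      LipschitzWith K χ₁ → LipschitzWith K χ₂ →
      LipschitzWith L (Windows2D.inCharts f χ₁ χ₂) →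
      AntilipschitzWith L (Windows2D.inCharts f χ₁ χ₂) →
      ∀ δ : ℝ, 0 < δ → ∀ N : ℕ, 0 < N → (K : ℝ) * ((L : ℝ) + 1) / (N : ℝ) < δ →
      ∀ S : Finset Windows2D.Square, Windows2D.IsSubdivision S →
      (∀ C ∈ S, C.side = 1 / (N : ℝ)) →
      ∀ C ∈ S, Windows2D.CompletelyLabeled φ C →
      ∀ p ∈ D.realize χ₁ (Windows2D.inCharts f χ₁ χ₂) C.toSet,
        Windows2D.IsApproxFixedPt δ f p) := by
  refine ⟨fun ⟨χ₁, χ₂, h⟩ => h.exists_fixedPt, ?_, ?_⟩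
  · intro χ₁ χ₂ φ h hφ S hS ψ hψ
    refine ⟨?_, fun C hC hind hnd => ?_⟩
    · obtain ⟨u, hu⟩ := h.boundaryLabels hφ
      obtain ⟨n, hn, hgrid⟩ := hS.exists_grid
      obtain ⟨i, hi, j, hj, hij⟩ := Windows2D.Square.exists_cell_squareIndex_ne_zero
        hu.nonDegenerate (hu.squareIndex_ne_zero hψ.surjective hψ.ne_neg) hn
      exact ⟨_, hgrid i hi j hj, hij⟩
    · have hsub := hS.toSet_subset hC
      obtain ⟨p, hp, -, hfp⟩ := Windows2D.exists_fixedPt_realize (h.1.eqOn h.2.1) hsub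
        (Windows2D.exists_fixedPt_of_squareIndex_ne_zero
          (D.labelMap (Windows2D.inCharts f χ₁ χ₂)).continuous (fun z hz => hφ z (hsub hz)) hnd hind)
      exact ⟨p, hp, hfp⟩
  · intro χ₁ χ₂ φ h₁ h₂ hφ K L _ _ hK₁ hK₂ hL hL' δ _ N _ hδ S hS hside C hC hcl p hp
    refine Windows2D.isApproxFixedPt_of_completelyLabeled (h₁.eqOn h₂) hφ hK₁ hK₂ hL hL'
      (hS.toSet_subset hC) ?_ hcl hp
    rw [hside C hC]
    calc (K : ℝ) * ((L + 1) * (1 / N)) = K * (L + 1) / N := by ring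
      _ < δ := hδ
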